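/- Let $\{p_j\}_{j\ge1}$ and $\{\alpha_j\}_{j\ge1}$ be sequences of positive real numbers such that (a) $\sum_j p_j<\infty$ and $\sum_j\alpha_j<\infty$; (b) there are $0<m<M<\infty$ with $p_{j+1}/p_j\in(m,M)$ for all $j$; (c) $\sup_j\alpha_j/p_j<\infty$. Let $\eta\ge0$ be an integer and let $\hat b=(\hat b_{ij})_{i,j\ge1}$ be a real matrix that is $\eta$-banded ($\hat b_{ij}=0$ whenever $|i-j|>\eta$) and satisfies (d) $|\hat b_{ij}|\le\alpha_i$ for all $i,j$; (e) $\hat b_{ij}=\hat b_{ji}$ for all $i,j$. Put $b=(\delta_{ij}+\hat b_{ij})_{i,j\ge1}$, and for $x\in\mathbb R^\infty$ (the space of all real sequences) let $(bx)_i=\sum_j b_{ij}x_j$, a finite sum. Let $\mu_G$ be the gaussian measure on $\mathbb R^\infty$, i.e. the countable product of standard gaussian measures on $\mathbb R$. Then: (1) The formula $(\hat Bx)_i=\sum_j\hat b_{ij}x_j$ defines a bounded operator $\hat B$ on the complex Hilbert space $\ell^2(\mathbb N)$, and $\hat B$ is of trace class, i.e. $\sum_i\langle|\hat B|e_i,e_i\rangle<\infty$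 for an orthonormal basis $\{e_i\}$, where $|\hat B|=(\hat B^*\hat B)^{1/2}$. (2) The Fredholm determinant $\det b=\det(I+\hat B)=\prod_j(1+\lambda_j)$, where $\lambda_j$ runs over the nonzero eigenvalues of $\hat B$ repeated according to algebraic multiplicity, is well defined (the multiplicities are finite, $\sum_j|\lambda_j|<\infty$, and the product converges); moreover, $\det b\ne0$ if and only if $I+\hat B$ is invertible as a bounded operator on $\ell^2(\mathbb N)$. (3) There is $C>0$ such that for every $x\in\mathbb R^\infty$ with $\sum_jx_j^2p_j<\infty$ the series $\sum_j\bigl(x_j^2-(bx)_j^2\bigr)$ converges absolutely and $$\Bigl|\sum_{j=1}^\infty\bigl(x_j^2-(bx)_j^2\bigr)\Bigr|\le C\sum_{j=1}^\infty x_j^2p_j .$$ (4) If $\det b\ne0$, then the transformation $B\colon\mathbb R^\infty\to\mathbb R^\infty$, $Bx=bx$, is invertible up to $\mu_G$-null sets: it is Borel measurable and there are Borel sets $D,E\subseteq\mathbb R^\infty$ of full measure $\mu_G$ such that $B$ restricts to a bijection of $D$ onto $E$ whose inverse $E\to D$ is Borel measurable. -/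

import Mathlib

open MeasureTheory ProbabilityTheory Filter Topology

noncomputable section

universe u

/-- A matrix indexed by `ℕ × ℕ` is `η`-banded if its entries vanish at distance more than `η`
from the diagonal. -/
def IsBanded (η : ℕ) (a : ℕ → ℕ → ℝ) : Prop :=
  ∀ i j : ℕ, (η : ℤ) < |(i : ℤ) - (j : ℤ)| → a i j = 0

/-- The matrix `(δ_{ij} + a_{ij})`. -/
def onePlus (a : ℕ → ℕ → ℝ) (i j : ℕ) : ℝ :=
  (if i = j then 1 else 0) + a i j

/-- The complex Hilbert space `ℓ²` of square-summable sequences. -/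
abbrev EllTwo : Type := lp (fun _ : ℕ => ℂ) 2

/-- The bounded operator `T` on `ℓ²` is induced by the real matrix `a`:
`(T x)_i = ∑_j a_{ij} x_j`. -/
def InducesOperator (a : ℕ → ℕ → ℝ) (T : EllTwo →L[ℂ] EllTwo) : Prop :=
  ∀ (x : EllTwo) (i : ℕ), HasSum (fun j => (a i j : ℂ) * x j) (T x i)

section Hilbert

variable {H : Type u} [NormedAddCommGroup H] [InnerProductSpace ℂ H] [CompleteSpace H]

/-- `T` is of trace class: with `|T| = (T* T)^{1/2}`, the series `∑ ⟨|T| e_i, e_i⟩` (which has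
nonnegative terms) converges for an orthonormal basis `(e_i)` of `H`. -/
def IsTraceClass (T : H →L[ℂ] H) : Prop :=
  ∃ (ι : Type u) (e : HilbertBasis ι ℂ H),
    Summable fun i => ‖inner ℂ (CFC.abs T (e i)) (e i)‖

/-- The generalized eigenspace (root space) `⋃_k ker (T - μ)^k`. -/
def rootSpace (T : H →L[ℂ] H) (μ : ℂ) : Submodule ℂ H :=
  Module.End.maxGenEigenspace (T : H →ₗ[ℂ] H) μ

/-- The algebraic multiplicity of `μ` as an eigenvalue of `T` (zero if `μ` is not an
eigenvalue). -/
def algMult (T : H →L[ℂ] H) (μ : ℂ) : ℕ :=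
  Module.finrank ℂ (rootSpace T μ)

/-- The Fredholm determinant `det (I + T) = ∏ (1 + λ_j)`, where the `λ_j` are the eigenvalues of
`T` repeated according to algebraic multiplicity (the eigenvalue `0` contributes the
factor `1`). -/
def fredholmDet (T : H →L[ℂ] H) : ℂ :=
  ∏' μ : ℂ, (1 + μ) ^ algMult T μ

/-- The Fredholm determinant `det (I + T)` is well defined: all nonzero eigenvalues have finite
algebraic multiplicity, the eigenvalues repeated according to multiplicity form an absolutely
summable family, and the product of the factors `1 + λ_j` converges. -/
def FredholmDetWellDefined (T : H →L[ℂ] H) : Prop :=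
  (∀ μ : ℂ, μ ≠ 0 → FiniteDimensional ℂ (rootSpace T μ)) ∧
  (Summable fun μ : ℂ => (algMult T μ : ℝ) * ‖μ‖) ∧
  Multipliable fun μ : ℂ => (1 + μ) ^ algMult T μ

end Hilbert

/-- The gaussian measure on `ℝ^∞`: the infinite product of standard gaussian measures on `ℝ`. -/
def gaussianInf : Measure (ℕ → ℝ) :=
  Measure.infinitePi fun _ : ℕ => gaussianReal 0 1

/-- `A : ℝ^∞ → ℝ^∞` is the everywhere defined transformation induced by the matrix `a`:
`(A x)_i = ∑_j a_{ij} x_j`, all series being convergent. -/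
def InducesTransformation (a : ℕ → ℕ → ℝ) (A : (ℕ → ℝ) → (ℕ → ℝ)) : Prop :=
  ∀ (x : ℕ → ℝ) (i : ℕ),
    Tendsto (fun n => ∑ j ∈ Finset.range n, a i j * x j) atTop (𝓝 (A x i))

/-- `B` is invertible up to `ν`-null sets: it restricts to a bijection between measurable sets
`D` and `E` of full measure, with an inverse given by a measurable map. -/
def InvertibleModNull {X : Type*} [MeasurableSpace X] (ν : Measure X) (B : X → X) : Prop :=
  Measurable B ∧
  ∃ (D E : Set X) (A : X → X),
    MeasurableSet D ∧ MeasurableSet E ∧ ν Dᶜ = 0 ∧ ν Eᶜ = 0 ∧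
    Set.MapsTo B D E ∧ Set.MapsTo A E D ∧ Set.InvOn A B D E ∧ Measurable A

end

/-! A row of `bhat` has at most `2η + 1` nonzero entries, each at most `α i`, so `∑ |bhat i j| < ∞`.
Hence the operator is an absolutely convergent series of rank one operators: compact, and
self-adjoint by symmetry. For such a series, Cauchy–Schwarz and Bessel bound the diagonal along any
orthonormal family; along an eigenbasis this reads `∑ |λ| < ∞`, giving both the trace class property
and the convergent determinant. Root spaces are eigenspaces, and the product vanishes iff some
factor does, i.e. iff `-1` is an eigenvalue, which by the Fredholm alternative means that `I + T` is
not invertible.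

For (3), expanding the square leaves sums of `|bhat i j| x_i²` and `|bhat i j| x_j²`; symmetry
exchanges them, and each is at most `(2η + 1) ∑ α_i x_i²`, hence a multiple of `∑ p_i x_i²`.

For (4), take `D = E = {∑ x_j² p_j < ∞}`, of full measure because the sum has finite expectation.
This space contains `ℓ²`, and `bhat` maps it into `ℓ²`, so solving `bx = y` in `D` reduces to
inverting `I + T` on `ℓ²`. Lusin–Souslin makes the inverse Borel. -/

section SpectralTheory

/-! ### Compact self-adjoint operators and the Fredholm determinant -/

variable {H : Type u} [NormedAddCommGroup H] [InnerProductSpace ℂ H]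

theorem rootSpace_eq_eigenspace {T : H →L[ℂ] H} (hs : T.IsSymmetric) (μ : ℂ) :
    rootSpace T μ = Module.End.eigenspace (T : H →ₗ[ℂ] H) μ :=
  (LinearMap.IsSymmetric.isFinitelySemisimple hs).maxGenEigenspace_eq_eigenspace μ

/-- The diagonal of an absolutely convergent series of rank one operators is absolutely summable
along every orthonormal family. -/
theorem HasSum.summable_norm_inner_of_rankOne {κ ι : Type*} {x y : κ → H} {T : H →L[ℂ] H}
    (hT : HasSum (fun n => InnerProductSpace.rankOne ℂ (x n) (y n)) T)
    (hxy : Summable fun n => ‖x n‖ * ‖y n‖) {e : ι → H} (he : Orthonormal ℂ e) :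
    Summable fun k => ‖inner ℂ (e k) (T (e k))‖ := by
  refine summable_of_sum_le (c := ∑' n, ‖x n‖ * ‖y n‖) (fun _ => norm_nonneg _) fun s => ?_
  -- Cauchy–Schwarz in `k`, then Bessel for `x n` and `y n`.
  have hterm (n : κ) : ∑ k ∈ s, ‖inner ℂ (e k) (x n)‖ * ‖inner ℂ (y n) (e k)‖
      ≤ ‖x n‖ * ‖y n‖ := by
    refine (Real.sum_mul_le_sqrt_mul_sqrt _ _ _).trans ?_
    gcongr
    · exact Real.sqrt_le_iff.2 ⟨norm_nonneg _, he.sum_inner_products_le _⟩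
    · refine Real.sqrt_le_iff.2 ⟨norm_nonneg _, ?_⟩
      simp_rw [norm_inner_symm (y n)]
      exact he.sum_inner_products_le _
  have hle (k : ι) : HasSum (fun n => inner ℂ (y n) (e k) * inner ℂ (e k) (x n))
      (inner ℂ (e k) (T (e k))) := by
    have := (hT.mapL (ContinuousLinearMap.apply ℂ H (e k))).mapL (innerSL ℂ (e k))
    simpa [InnerProductSpace.rankOne_apply, inner_smul_right] using this
  have hsm (k : ι) : Summable fun n => ‖inner ℂ (e k) (x n)‖ * ‖inner ℂ (y n) (e k)‖ := by
    refine hxy.of_nonneg_of_le (fun n => by positivity) fun n => ?_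
    have h1 := norm_inner_le_norm (𝕜 := ℂ) (e k) (x n)
    have h2 := norm_inner_le_norm (𝕜 := ℂ) (y n) (e k)
    rw [he.1 k] at h1 h2
    simp only [one_mul, mul_one] at h1 h2
    gcongr
  calc ∑ k ∈ s, ‖inner ℂ (e k) (T (e k))‖
      ≤ ∑ k ∈ s, ∑' n, ‖inner ℂ (e k) (x n)‖ * ‖inner ℂ (y n) (e k)‖ := by
        refine Finset.sum_le_sum fun k _ => ?_
        rw [← (hle k).tsum_eq]
        refine (norm_tsum_le_tsum_norm ?_).trans_eq (tsum_congr fun n => ?_)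
        · exact (hsm k).congr fun n => by rw [norm_mul, mul_comm]
        · rw [norm_mul, mul_comm]
    _ = ∑' n, ∑ k ∈ s, ‖inner ℂ (e k) (x n)‖ * ‖inner ℂ (y n) (e k)‖ :=
        (Summable.tsum_finsetSum fun k _ => hsm k).symm
    _ ≤ ∑' n, ‖x n‖ * ‖y n‖ :=
        Summable.tsum_le_tsum hterm (summable_sum fun k _ => hsm k) hxy

variable [CompleteSpace H]

/-- A compact self-adjoint operator has a Hilbert basis of eigenvectors, obtained by joining
Hilbert bases of its eigenspaces. -/
theorem IsCompactOperator.exists_hilbertBasis_eigenspaces {T : H →L[ℂ] H}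
    (hT : IsCompactOperator T) (hs : T.IsSymmetric) :
    ∃ (w : ℂ → Type u)
      (v : ∀ μ, HilbertBasis (w μ) ℂ (Module.End.eigenspace (T : H →ₗ[ℂ] H) μ))
      (e : HilbertBasis (Σ μ, w μ) ℂ H), ∀ k, e k = v k.1 k.2 := by
  have hc (μ : ℂ) : CompleteSpace (Module.End.eigenspace (T : H →ₗ[ℂ] H) μ) := by
    have : IsClosed (Module.End.eigenspace (T : H →ₗ[ℂ] H) μ : Set H) := by
      have h : (Module.End.eigenspace (T : H →ₗ[ℂ] H) μ : Set H) = {x | T x = μ • x} := by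
        ext x
        simp
      rw [h]
      exact isClosed_eq T.continuous (continuous_const_smul μ)
    exact this.completeSpace_coe
  have hb (μ : ℂ) := exists_hilbertBasis ℂ (Module.End.eigenspace (T : H →ₗ[ℂ] H) μ)
  choose w v _ using hb
  have ho : Orthonormal ℂ fun k : Σ μ, w μ => (v k.1 k.2 : H) :=
    hs.orthogonalFamily_eigenspaces.orthonormal_sigma_orthonormal
      (v_family := fun μ => v μ) fun μ => (v μ).orthonormal
  have hspan : (Submodule.span ℂ (Set.range fun k : Σ μ, w μ => (v k.1 k.2 : H)))ᗮ = ⊥ := by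
    rw [eq_bot_iff, ← ContinuousLinearMap.orthogonalComplement_iSup_eigenspaces_eq_bot hT hs]
    intro x hx
    rw [Submodule.mem_orthogonal] at hx
    rw [← Submodule.iInf_orthogonal, Submodule.mem_iInf]
    intro μ
    rw [Submodule.mem_orthogonal]
    intro y hy
    have hsum := (v μ).hasSum_repr ⟨y, hy⟩
    have hsum' := (hsum.mapL (Submodule.subtypeL _)).mapL (innerSL ℂ x)
    have hz : HasSum (fun _ : w μ => (0 : ℂ)) (inner ℂ x y) := by
      have hc (i : w μ) : innerSL ℂ x (Submodule.subtypeL _ ((v μ).repr ⟨y, hy⟩ i • v μ i)) = 0 := by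
        have := hx (v μ i) (Submodule.subset_span ⟨⟨μ, i⟩, rfl⟩)
        simp [inner_eq_zero_symm.1 this]
      simp only [hc] at hsum'
      exact hsum'
    exact inner_eq_zero_symm.1 (hz.unique hasSum_zero)
  exact ⟨fun μ => w μ, v, HilbertBasis.mkOfOrthogonalEqBot ho hspan, fun k => by
    rw [HilbertBasis.coe_mkOfOrthogonalEqBot]⟩

theorem norm_cfcAbs_apply (T : H →L[ℂ] H) (x : H) : ‖CFC.abs T x‖ = ‖T x‖ := by
  have h1 : inner ℂ (CFC.abs T x) (CFC.abs T x) = inner ℂ (T x) (T x) := by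
    have hsa : IsSelfAdjoint (CFC.abs T) := (CFC.abs_nonneg T).isSelfAdjoint
    have h2 := ContinuousLinearMap.adjoint_inner_right (CFC.abs T) x (CFC.abs T x)
    rw [hsa.adjoint_eq] at h2
    rw [← h2, ← ContinuousLinearMap.adjoint_inner_right T x (T x)]
    exact congrArg (fun S : H →L[ℂ] H => inner ℂ x (S x)) (CFC.abs_mul_abs T)
  rw [inner_self_eq_norm_sq_to_K, inner_self_eq_norm_sq_to_K] at h1
  have h3 : ‖CFC.abs T x‖ ^ 2 = ‖T x‖ ^ 2 := by exact_mod_cast h1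
  exact (sq_eq_sq₀ (norm_nonneg _) (norm_nonneg _)).1 h3

/-- A limit of a series of rank one operators is compact. -/
theorem HasSum.isCompactOperator_of_rankOne {κ : Type*} {x y : κ → H} {T : H →L[ℂ] H}
    (hT : HasSum (fun n => InnerProductSpace.rankOne ℂ (x n) (y n)) T) : IsCompactOperator T := by
  have hr (n : κ) : IsCompactOperator (InnerProductSpace.rankOne ℂ (x n) (y n)) := by
    have : InnerProductSpace.rankOne ℂ (x n) (y n)
        = (ContinuousLinearMap.toSpanSingleton ℂ (x n)) ∘L (innerSL ℂ (y n)) := by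
      ext z
      simp [InnerProductSpace.rankOne_apply]
    rw [this]
    have hc : IsCompactOperator (innerSL ℂ (y n)) := by
      refine ⟨Metric.closedBall 0 ‖(1 : ℝ)‖, isCompact_closedBall _ _, ?_⟩
      exact (innerSL ℂ (y n)).continuous.continuousAt.preimage_mem_nhds
        (by simpa using Metric.closedBall_mem_nhds (0 : ℂ) one_pos)
    exact hc.clm_comp (ContinuousLinearMap.toSpanSingleton ℂ (x n))
  have hmem (s : Finset κ) :
      IsCompactOperator ⇑(∑ n ∈ s, InnerProductSpace.rankOne ℂ (x n) (y n)) := by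
    exact sum_mem (S := compactOperator (RingHom.id ℂ) H H)
      (f := fun n => InnerProductSpace.rankOne ℂ (x n) (y n)) fun n _ => hr n
  exact isCompactOperator_of_tendsto hT (Eventually.of_forall hmem)

/-- On a unit eigenvector, `⟨|T|e, e⟩ ≤ ‖|T|e‖ = ‖Te‖ = |λ| = |⟨e, Te⟩|`, so the diagonal bound
suffices and `|T|` need not be diagonalized. -/
theorem isTraceClass_of_hasSum_rankOne {κ : Type*} {x y : κ → H} {T : H →L[ℂ] H}
    (hT : HasSum (fun n => InnerProductSpace.rankOne ℂ (x n) (y n)) T)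
    (hxy : Summable fun n => ‖x n‖ * ‖y n‖) (hs : T.IsSymmetric) : IsTraceClass T := by
  obtain ⟨w, v, e, hev⟩ := hT.isCompactOperator_of_rankOne.exists_hilbertBasis_eigenspaces hs
  refine ⟨_, e, (hT.summable_norm_inner_of_rankOne hxy e.orthonormal).of_nonneg_of_le
    (fun _ => norm_nonneg _) fun k => ?_⟩
  have hTe : T (e k) = k.1 • e k := by
    rw [hev]
    exact Module.End.mem_eigenspace_iff.1 (v k.1 k.2).2
  calc ‖inner ℂ (CFC.abs T (e k)) (e k)‖ ≤ ‖CFC.abs T (e k)‖ * ‖e k‖ := norm_inner_le_norm _ _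
    _ = ‖k.1‖ := by
      rw [norm_cfcAbs_apply, hTe, norm_smul, e.orthonormal.1 k, mul_one, mul_one]
    _ = ‖inner ℂ (e k) (T (e k))‖ := by
      rw [hTe, inner_smul_right, inner_self_eq_norm_sq_to_K, e.orthonormal.1 k]
      simp

/-- For a self-adjoint operator given by an absolutely convergent series of rank one operators the
Fredholm determinant is well defined, and it vanishes exactly when `I + T` is not invertible. -/
theorem fredholmDet_of_hasSum_rankOne {κ : Type*} {x y : κ → H} {T : H →L[ℂ] H}
    (hT : HasSum (fun n => InnerProductSpace.rankOne ℂ (x n) (y n)) T)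
    (hxy : Summable fun n => ‖x n‖ * ‖y n‖) (hs : T.IsSymmetric) :
    FredholmDetWellDefined T ∧ (fredholmDet T ≠ 0 ↔ IsUnit (1 + T)) := by
  have hc : IsCompactOperator T := hT.isCompactOperator_of_rankOne
  obtain ⟨w, v, e, hev⟩ := hc.exists_hilbertBasis_eigenspaces hs
  have hfin (μ : ℂ) (hμ : μ ≠ 0) :
      FiniteDimensional ℂ (Module.End.eigenspace (T : H →ₗ[ℂ] H) μ) :=
    ContinuousLinearMap.finite_dimensional_eigenspace hc μ hμ
  have hfw (μ : ℂ) (hμ : μ ≠ 0) : Finite (w μ) :=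
    have := hfin μ hμ
    (v μ).orthonormal.linearIndependent.finite
  have hcard (μ : ℂ) (hμ : μ ≠ 0) : algMult T μ = Nat.card (w μ) := by
    have := hfw μ hμ
    let := Fintype.ofFinite (w μ)
    rw [algMult, rootSpace_eq_eigenspace hs,
      Module.finrank_eq_card_basis (v μ).toOrthonormalBasis.toBasis, Nat.card_eq_fintype_card]
  have hsum : Summable fun k : Σ μ, w μ => ‖k.1‖ := by
    refine (hT.summable_norm_inner_of_rankOne hxy e.orthonormal).congr fun k => ?_
    have hTe : T (e k) = k.1 • e k := by
      rw [hev]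
      exact Module.End.mem_eigenspace_iff.1 (v k.1 k.2).2
    rw [hTe, inner_smul_right, inner_self_eq_norm_sq_to_K, e.orthonormal.1 k]
    simp
  -- Group the product over basis vectors by eigenvalue.
  have hprod : HasProd (fun μ : ℂ => (1 + μ) ^ algMult T μ) (∏' k : Σ μ, w μ, (1 + k.1)) := by
    refine (multipliable_one_add_of_summable hsum).hasProd.sigma fun μ => ?_
    -- The kernel may be infinite-dimensional, with `finrank` defaulting to `0`; its factors are all
    -- `1`.
    rcases eq_or_ne μ 0 with rfl | hμ
    · simp
    · have := hfw μ hμ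
      let := Fintype.ofFinite (w μ)
      have h := hasProd_fintype (fun _ : w μ => 1 + μ)
      rwa [Finset.prod_const, Finset.card_univ, ← Nat.card_eq_fintype_card, ← hcard μ hμ] at h
  have hker : (∃ k : Σ μ, w μ, 1 + k.1 = 0) ↔ ¬ IsUnit (1 + T) := by
    have hspec : ¬ IsUnit (1 + T) ↔ (-1 : ℂ) ∈ spectrum ℂ T := by
      rw [spectrum.mem_iff, not_iff_not, ← IsUnit.neg_iff]
      simp [sub_eq_add_neg, add_comm]
    -- Fredholm alternative: nonzero spectral values of a compact operator are eigenvalues.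
    rw [hspec, ← hc.hasEigenvalue_iff_mem_spectrum (by simp), Module.End.hasEigenvalue_iff]
    constructor
    · rintro ⟨⟨μ, i⟩, hk⟩ hbot
      obtain rfl : μ = -1 := by linear_combination hk
      have h0 := (Submodule.eq_bot_iff _).1 hbot _ (v (-1) i).2
      exact (v (-1)).orthonormal.ne_zero i (Subtype.ext h0)
    · intro hne
      have hm : algMult T (-1) ≠ 0 := by
        rw [algMult, rootSpace_eq_eigenspace hs]
        have := hfin (-1) (by simp)
        exact fun h => hne (Submodule.finrank_eq_zero.1 h)
      rw [hcard _ (by simp)] at hm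
      obtain ⟨i⟩ := (Nat.card_ne_zero.1 hm).1
      exact ⟨⟨-1, i⟩, by simp⟩
  refine ⟨⟨fun μ hμ => ?_, ?_, hprod.multipliable⟩, ?_⟩
  · rw [rootSpace_eq_eigenspace hs]
    exact hfin μ hμ
  · refine ((summable_sigma_of_nonneg fun k => norm_nonneg k.1).1 hsum).2.congr fun μ => ?_
    rcases eq_or_ne μ 0 with rfl | hμ
    · simp
    · simp only [hcard μ hμ, tsum_const, nsmul_eq_mul]
  · rw [fredholmDet, hprod.tprod_eq, ← not_iff_not, ← hker, not_not]
    constructor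
    · intro h0
      by_contra hne
      exact tprod_one_add_ne_zero_of_summable (fun k hk => hne ⟨k, hk⟩) hsum h0
    · exact fun ⟨k, hk⟩ => tprod_of_exists_eq_zero ⟨k, hk⟩

end SpectralTheory

/-! ### Weighted estimates for banded matrices -/

section BandedMatrix

/-- The indices at distance at most `η` from `i`. -/
def band (η i : ℕ) : Finset ℕ := Finset.Icc (i - η) (i + η)

theorem card_band_le (η i : ℕ) : (band η i).card ≤ 2 * η + 1 := by
  rw [band, Nat.card_Icc]
  lia

theorem IsBanded.eq_zero {η : ℕ} {a : ℕ → ℕ → ℝ} (ha : IsBanded η a) {i j : ℕ}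
    (hj : j ∉ band η i) : a i j = 0 := by
  refine ha i j ?_
  rw [band, Finset.mem_Icc] at hj
  grind

/-- The product of an `η`-banded matrix with a sequence. -/
def bandedMulVec (η : ℕ) (a : ℕ → ℕ → ℝ) (x : ℕ → ℝ) (i : ℕ) : ℝ :=
  ∑ j ∈ band η i, a i j * x j

theorem hasSum_bandedMulVec {η : ℕ} {a : ℕ → ℕ → ℝ} (ha : IsBanded η a) (x : ℕ → ℝ) (i : ℕ) :
    HasSum (fun j => a i j * x j) (bandedMulVec η a x i) :=
  hasSum_sum_of_ne_finset_zero fun j hj => by rw [ha.eq_zero hj, zero_mul]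

theorem hasSum_onePlus_mul {η : ℕ} {a : ℕ → ℕ → ℝ} (ha : IsBanded η a) (x : ℕ → ℝ) (i : ℕ) :
    HasSum (fun j => onePlus a i j * x j) (x i + bandedMulVec η a x i) := by
  have h : HasSum (fun j => (if j = i then x i else 0) + a i j * x j)
      (x i + bandedMulVec η a x i) :=
    (hasSum_ite_eq i (x i)).add (hasSum_bandedMulVec ha x i)
  convert h using 2 with j
  unfold onePlus
  rcases eq_or_ne i j with rfl | hij
  · simp [add_mul]
  · simp [hij, hij.symm]

theorem measurable_bandedMulVec (η : ℕ) (a : ℕ → ℕ → ℝ) : Measurable (bandedMulVec η a) := by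
  unfold bandedMulVec
  fun_prop

variable {η : ℕ} {a : ℕ → ℕ → ℝ} {α : ℕ → ℝ}

theorem sum_band_abs_le (h_bound : ∀ i j, |a i j| ≤ α i) (i : ℕ) :
    ∑ j ∈ band η i, |a i j| ≤ (2 * η + 1) * α i := by
  have hα : 0 ≤ α i := (abs_nonneg _).trans (h_bound i i)
  refine (Finset.sum_le_card_nsmul _ _ _ fun j _ => h_bound i j).trans ?_
  rw [nsmul_eq_mul]
  gcongr
  exact_mod_cast card_band_le η i

theorem hasSum_abs_mul (ha : IsBanded η a) (f : ℕ → ℝ) (i : ℕ) :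
    HasSum (fun j => |a i j| * f j) (∑ j ∈ band η i, |a i j| * f j) :=
  hasSum_sum_of_ne_finset_zero fun j hj => by rw [ha.eq_zero hj, abs_zero, zero_mul]

/-- Weighted row sums of `|a|` are summable, with a bound on the sum. -/
theorem summable_abs_mul_fst (ha : IsBanded η a) (h_bound : ∀ i j, |a i j| ≤ α i) {f : ℕ → ℝ}
    (hf : ∀ i, 0 ≤ f i) (hs : Summable fun i => α i * f i) :
    (Summable fun q : ℕ × ℕ => |a q.1 q.2| * f q.1) ∧
      ∑' q : ℕ × ℕ, |a q.1 q.2| * f q.1 ≤ (2 * η + 1) * ∑' i, α i * f i := by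
  have hrow (i : ℕ) : HasSum (fun j => |a i j| * f i) (∑ j ∈ band η i, |a i j| * f i) :=
    hasSum_abs_mul ha (fun _ => f i) i
  have hle (i : ℕ) : ∑' j, |a i j| * f i ≤ (2 * η + 1) * (α i * f i) := by
    rw [(hrow i).tsum_eq, ← Finset.sum_mul, ← mul_assoc]
    exact mul_le_mul_of_nonneg_right (sum_band_abs_le h_bound i) (hf i)
  have hsum : Summable fun i => ∑' j, |a i j| * f i :=
    (hs.mul_left _).of_nonneg_of_le
      (fun i => tsum_nonneg fun j => mul_nonneg (abs_nonneg _) (hf i)) hle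
  have hprod : Summable fun q : ℕ × ℕ => |a q.1 q.2| * f q.1 :=
    (summable_prod_of_nonneg fun q => mul_nonneg (abs_nonneg _) (hf q.1)).2
      ⟨fun i => (hrow i).summable, hsum⟩
  refine ⟨hprod, ?_⟩
  rw [hprod.tsum_prod, ← tsum_mul_left]
  exact hsum.tsum_le_tsum hle (hs.mul_left _)

/-- The bound by `α` controls rows only; symmetry transposes the double sum. -/
theorem summable_abs_mul_snd (ha : IsBanded η a) (h_bound : ∀ i j, |a i j| ≤ α i)
    (h_symm : ∀ i j, a i j = a j i) {f : ℕ → ℝ}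
    (hf : ∀ i, 0 ≤ f i) (hs : Summable fun i => α i * f i) :
    (Summable fun q : ℕ × ℕ => |a q.1 q.2| * f q.2) ∧
      ∑' q : ℕ × ℕ, |a q.1 q.2| * f q.2 ≤ (2 * η + 1) * ∑' i, α i * f i := by
  obtain ⟨h1, h2⟩ := summable_abs_mul_fst ha h_bound hf hs
  have heq : (fun q : ℕ × ℕ => |a q.1 q.2| * f q.2) =
      (fun q : ℕ × ℕ => |a q.1 q.2| * f q.1) ∘ Equiv.prodComm ℕ ℕ := by
    funext q
    simp [h_symm q.1 q.2]
  refine ⟨heq ▸ (Equiv.prodComm ℕ ℕ).summable_iff.2 h1, ?_⟩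
  rw [heq]
  exact ((Equiv.prodComm ℕ ℕ).tsum_eq fun q : ℕ × ℕ => |a q.1 q.2| * f q.1).trans_le h2

/-- Cauchy–Schwarz with `|a i j|` split evenly between the factors; the remaining weight `|a i j|`
keeps the right side summable over `i`. -/
theorem sq_bandedMulVec_le (h_bound : ∀ i j, |a i j| ≤ α i) (x : ℕ → ℝ) (i : ℕ) :
    bandedMulVec η a x i ^ 2 ≤ (2 * η + 1) * α i * ∑ j ∈ band η i, |a i j| * x j ^ 2 := by
  have hnn (j : ℕ) : 0 ≤ |a i j| * x j ^ 2 := by positivity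
  refine (Finset.sum_sq_le_sum_mul_sum_of_sq_le_mul (band η i) (f := fun j => |a i j|)
    (g := fun j => |a i j| * x j ^ 2) (fun j _ => abs_nonneg _) (fun j _ => hnn j)
    fun j _ => ?_).trans ?_
  · rw [← mul_assoc, abs_mul_abs_self, mul_pow, sq (a i j)]
  · exact mul_le_mul_of_nonneg_right (sum_band_abs_le h_bound i)
      (Finset.sum_nonneg fun j _ => hnn j)

theorem abs_sq_sub_sq_le (h_bound : ∀ i j, |a i j| ≤ α i) (x : ℕ → ℝ) (i : ℕ) :
    |x i ^ 2 - (x i + bandedMulVec η a x i) ^ 2| ≤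
      ∑ j ∈ band η i, |a i j| * x i ^ 2 +
        (1 + (2 * η + 1) * α i) * ∑ j ∈ band η i, |a i j| * x j ^ 2 := by
  have h1 := sq_bandedMulVec_le (η := η) h_bound x i
  have h2 : |2 * x i * bandedMulVec η a x i| ≤
      ∑ j ∈ band η i, |a i j| * x i ^ 2 + ∑ j ∈ band η i, |a i j| * x j ^ 2 := by
    rw [bandedMulVec, Finset.mul_sum, ← Finset.sum_add_distrib]
    refine (Finset.abs_sum_le_sum_abs _ _).trans (Finset.sum_le_sum fun j _ => ?_)
    have h3 : 2 * |x i| * |x j| ≤ x i ^ 2 + x j ^ 2 := by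
      rw [← sq_abs (x i), ← sq_abs (x j)]
      exact two_mul_le_add_sq _ _
    calc |2 * x i * (a i j * x j)| = |a i j| * (2 * |x i| * |x j|) := by
          simp only [abs_mul, abs_two]
          ring
      _ ≤ |a i j| * (x i ^ 2 + x j ^ 2) := by gcongr
      _ = _ := by ring
  calc |x i ^ 2 - (x i + bandedMulVec η a x i) ^ 2|
      = |-(2 * x i * bandedMulVec η a x i) + -(bandedMulVec η a x i ^ 2)| := by
        congr 1
        ring
    _ ≤ |2 * x i * bandedMulVec η a x i| + bandedMulVec η a x i ^ 2 := by
        refine (abs_add_le _ _).trans_eq ?_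
        rw [abs_neg, abs_neg, abs_of_nonneg (sq_nonneg (bandedMulVec η a x i))]
    _ ≤ _ := by linarith

variable {p : ℕ → ℝ} {K : ℝ} {x : ℕ → ℝ}

theorem summable_mul_sq_of_le (hα : ∀ i, 0 ≤ α i) (hαp : ∀ i, α i ≤ K * p i)
    (hx : Summable fun i => x i ^ 2 * p i) :
    (Summable fun i => α i * x i ^ 2) ∧ ∑' i, α i * x i ^ 2 ≤ K * ∑' i, x i ^ 2 * p i := by
  have hle (i : ℕ) : α i * x i ^ 2 ≤ K * (x i ^ 2 * p i) := by
    nlinarith [hαp i, sq_nonneg (x i)]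
  have hs : Summable fun i => α i * x i ^ 2 :=
    (hx.mul_left K).of_nonneg_of_le (fun i => mul_nonneg (hα i) (sq_nonneg _)) hle
  exact ⟨hs, tsum_mul_left (a := K) (f := fun i => x i ^ 2 * p i) ▸
    hs.tsum_le_tsum hle (hx.mul_left K)⟩

/-- A symmetric banded matrix dominated by a summable sequence maps a weighted `ℓ²` space
into `ℓ²`. -/
theorem summable_sq_bandedMulVec (ha : IsBanded η a) (h_bound : ∀ i j, |a i j| ≤ α i)
    (h_symm : ∀ i j, a i j = a j i) (hα_sum : Summable α)
    (hx : Summable fun i => α i * x i ^ 2) :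
    Summable fun i => bandedMulVec η a x i ^ 2 := by
  have hα (i : ℕ) : 0 ≤ α i := (abs_nonneg _).trans (h_bound i i)
  have h := (summable_abs_mul_snd ha h_bound h_symm (fun i => sq_nonneg (x i)) hx).1.prod
  have h' : Summable fun i => ∑ j ∈ band η i, |a i j| * x j ^ 2 :=
    h.congr fun i => (hasSum_abs_mul ha (fun j => x j ^ 2) i).tsum_eq
  refine (h'.mul_left ((2 * η + 1) * ∑' i, α i)).of_nonneg_of_le (fun i => sq_nonneg _)
    fun i => (sq_bandedMulVec_le h_bound x i).trans ?_
  have := hα_sum.le_tsum i fun j _ => hα j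
  have hnn : 0 ≤ ∑ j ∈ band η i, |a i j| * x j ^ 2 :=
    Finset.sum_nonneg fun j _ => by positivity
  gcongr

theorem summable_sq_sub_sq (ha : IsBanded η a) (h_bound : ∀ i j, |a i j| ≤ α i)
    (h_symm : ∀ i j, a i j = a j i) (hα_sum : Summable α)
    (hx : Summable fun i => α i * x i ^ 2) :
    (Summable fun i => x i ^ 2 - (x i + bandedMulVec η a x i) ^ 2) ∧
      |∑' i, (x i ^ 2 - (x i + bandedMulVec η a x i) ^ 2)| ≤
        (2 + (2 * η + 1) * ∑' i, α i) * ((2 * η + 1) * ∑' i, α i * x i ^ 2) := by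
  have hα (i : ℕ) : 0 ≤ α i := (abs_nonneg _).trans (h_bound i i)
  obtain ⟨h1, h1'⟩ := summable_abs_mul_fst ha h_bound (fun i => sq_nonneg (x i)) hx
  obtain ⟨h2, h2'⟩ := summable_abs_mul_snd ha h_bound h_symm (fun i => sq_nonneg (x i)) hx
  have e1 (i : ℕ) : ∑' j, |a i j| * x i ^ 2 = ∑ j ∈ band η i, |a i j| * x i ^ 2 :=
    (hasSum_abs_mul ha (fun _ => x i ^ 2) i).tsum_eq
  have e2 (i : ℕ) : ∑' j, |a i j| * x j ^ 2 = ∑ j ∈ band η i, |a i j| * x j ^ 2 :=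
    (hasSum_abs_mul ha (fun j => x j ^ 2) i).tsum_eq
  rw [h1.tsum_prod] at h1'
  rw [h2.tsum_prod] at h2'
  have s1 := h1.prod
  have s2 := h2.prod
  simp only [e1, e2] at h1' h2' s1 s2
  have hle (i : ℕ) : ‖x i ^ 2 - (x i + bandedMulVec η a x i) ^ 2‖ ≤
      ∑ j ∈ band η i, |a i j| * x i ^ 2 +
        (1 + (2 * η + 1) * ∑' i, α i) * ∑ j ∈ band η i, |a i j| * x j ^ 2 := by
    refine (abs_sq_sub_sq_le h_bound x i).trans ?_
    -- Replacing `α i` by the total sum makes the coefficient uniform in `i`.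
    have := hα_sum.le_tsum i fun j _ => hα j
    have hnn : 0 ≤ ∑ j ∈ band η i, |a i j| * x j ^ 2 :=
      Finset.sum_nonneg fun j _ => by positivity
    gcongr
  have hdom := s1.add (s2.mul_left (1 + (2 * η + 1) * ∑' i, α i))
  refine ⟨hdom.of_norm_bounded hle, ?_⟩
  rw [← Real.norm_eq_abs]
  refine (tsum_of_norm_bounded hdom.hasSum hle).trans ?_
  rw [s1.tsum_add (s2.mul_left _), tsum_mul_left]
  have hS : 0 ≤ ∑' i, α i := tsum_nonneg hα
  -- The first double sum counts once and the second `1 + (2η + 1) ∑ α` times, whence the constant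
  -- `2 + …`.
  have := mul_le_mul_of_nonneg_left h2'
    (show (0 : ℝ) ≤ 1 + (2 * η + 1) * ∑' i, α i by positivity)
  linarith

end BandedMatrix

/-! ### A Borel set of full gaussian measure, and Borel inverses -/

section GaussianMeasure

theorem measurableSet_summable_sq_mul {p : ℕ → ℝ} (hp : ∀ j, 0 ≤ p j) :
    MeasurableSet {x : ℕ → ℝ | Summable fun j => x j ^ 2 * p j} := by
  have h : {x : ℕ → ℝ | Summable fun j => x j ^ 2 * p j} =
      {x | ∑' j, ENNReal.ofReal (x j ^ 2 * p j) ≠ ⊤} := by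
    ext x
    refine ⟨fun hx => hx.tsum_ofReal_ne_top, fun hx => ?_⟩
    refine (ENNReal.summable_toReal hx).congr fun j => ?_
    exact ENNReal.toReal_ofReal (mul_nonneg (sq_nonneg _) (hp j))
  rw [h]
  exact (measurableSet_singleton _).compl.preimage (by fun_prop)

/-- The expectation of `∑ x_j² p_j` is `c ∑ p_j < ∞`, with `c` the second moment of one coordinate.
-/
theorem gaussianInf_compl_summable_sq_mul {p : ℕ → ℝ} (hp : ∀ j, 0 ≤ p j) (hs : Summable p) :
    gaussianInf {x : ℕ → ℝ | Summable fun j => x j ^ 2 * p j}ᶜ = 0 := by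
  set c : ENNReal := ∫⁻ t, ENNReal.ofReal (t ^ 2) ∂(gaussianReal 0 1) with hc
  have hctop : c ≠ ⊤ := by
    have h : Integrable (fun t : ℝ => t ^ 2) (gaussianReal 0 1) :=
      (memLp_id_gaussianReal' 2 (by simp)).integrable_sq
    rw [hc, ← ofReal_integral_eq_lintegral_ofReal h (Eventually.of_forall fun t => sq_nonneg t)]
    exact ENNReal.ofReal_ne_top
  have hterm (j : ℕ) : ∫⁻ x, ENNReal.ofReal (x j ^ 2 * p j) ∂gaussianInf
      = c * ENNReal.ofReal (p j) := by
    have hmp : MeasurePreserving (fun x : ℕ → ℝ => x j) gaussianInf (gaussianReal 0 1) :=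
      measurePreserving_eval_infinitePi (fun _ : ℕ => gaussianReal 0 1) j
    have h := hmp.lintegral_comp (f := fun t => ENNReal.ofReal (t ^ 2)) (by fun_prop)
    simp_rw [ENNReal.ofReal_mul (sq_nonneg _)]
    rw [lintegral_mul_const _ (by fun_prop), h]
  have hint : ∫⁻ x, ∑' j, ENNReal.ofReal (x j ^ 2 * p j) ∂gaussianInf ≠ ⊤ := by
    have hm (j : ℕ) : Measurable fun x : ℕ → ℝ => ENNReal.ofReal (x j ^ 2 * p j) := by fun_prop
    rw [lintegral_tsum fun j => (hm j).aemeasurable]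
    simp_rw [hterm]
    rw [ENNReal.tsum_mul_left]
    exact ENNReal.mul_ne_top hctop hs.tsum_ofReal_ne_top
  have hae := ae_lt_top (by fun_prop) hint
  rw [← mem_ae_iff]
  filter_upwards [hae] with x hx
  refine (ENNReal.summable_toReal hx.ne).congr fun j => ?_
  exact ENNReal.toReal_ofReal (mul_nonneg (sq_nonneg _) (hp j))

/-- A measurable map that restricts to a bijection of a measurable set of full measure is invertible
up to null sets. -/
theorem invertibleModNull_of_bijOn {X : Type*} [MeasurableSpace X] [StandardBorelSpace X]
    {ν : Measure X} {B : X → X} (hB : Measurable B) {D : Set X} (hD : MeasurableSet D)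
    (hν : ν Dᶜ = 0) (hne : D.Nonempty) (hbij : Set.BijOn B D D) : InvertibleModNull ν B := by
  have : StandardBorelSpace D := hD.standardBorel
  have : Nonempty D := hne.to_subtype
  -- Lusin–Souslin: an injective Borel map on a standard Borel space is a measurable embedding.
  have hemb : MeasurableEmbedding (D.domRestrict B) :=
    (hB.comp measurable_subtype_coe).measurableEmbedding hbij.injOn.injective
  have hleft (x : X) (hx : x ∈ D) : (hemb.invFun (B x) : X) = x :=
    congrArg Subtype.val (hemb.leftInverse_invFun ⟨x, hx⟩)
  refine ⟨hB, D, D, fun y => hemb.invFun y, hD, hD, hν, hν, hbij.mapsTo,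
    fun y _ => (hemb.invFun y).2, ⟨hleft, fun y hy => ?_⟩,
    measurable_subtype_coe.comp hemb.measurable_invFun⟩
  obtain ⟨x, hx, rfl⟩ := hbij.surjOn hy
  exact congrArg B (hleft x hx)

end GaussianMeasure

/-! ### From summable matrices to operators on `ℓ²` -/

section MatrixOperator

theorem EllTwo.inner_single_one (i : ℕ) (z : EllTwo) :
    inner ℂ (lp.single 2 i (1 : ℂ) : EllTwo) z = z i := by
  simp [lp.inner_single_left]

/-- A symmetric matrix with absolutely summable entries is the matrix of a self-adjoint absolutely
convergent series of rank one operators on `ℓ²`. -/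
theorem exists_hasSum_rankOne_of_summable {a : ℕ → ℕ → ℝ}
    (ha : Summable fun q : ℕ × ℕ => |a q.1 q.2|) (h_symm : ∀ i j, a i j = a j i) :
    ∃ (T : EllTwo →L[ℂ] EllTwo) (x y : ℕ × ℕ → EllTwo),
      HasSum (fun q => InnerProductSpace.rankOne ℂ (x q) (y q)) T ∧
      (Summable fun q => ‖x q‖ * ‖y q‖) ∧ T.IsSymmetric ∧ InducesOperator a T := by
  let x (q : ℕ × ℕ) : EllTwo := (a q.1 q.2 : ℂ) • lp.single 2 q.1 (1 : ℂ)
  let y (q : ℕ × ℕ) : EllTwo := lp.single 2 q.2 (1 : ℂ)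
  have hxy (q : ℕ × ℕ) : ‖x q‖ * ‖y q‖ = |a q.1 q.2| := by
    simp only [x, y, norm_smul, lp.norm_single (by simp : (0 : ENNReal) < 2), norm_one, mul_one,
      Complex.norm_real, Real.norm_eq_abs]
  have hsum : Summable fun q => ‖x q‖ * ‖y q‖ := ha.congr fun q => (hxy q).symm
  have hT : Summable fun q => InnerProductSpace.rankOne ℂ (x q) (y q) :=
    .of_norm (hsum.congr fun q => (InnerProductSpace.norm_rankOne _ _).symm)
  refine ⟨_, x, y, hT.hasSum, hsum, ?_, fun z i => ?_⟩
  · rw [← ContinuousLinearMap.isSelfAdjoint_iff_isSymmetric, IsSelfAdjoint]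
    -- Adjoints swap the two vectors of each term; as the entries are real and symmetric, this only
    -- reindexes the series by `(i, j) ↦ (j, i)`.
    refine hT.hasSum.star.unique ?_
    have h := (Equiv.prodComm ℕ ℕ).hasSum_iff.2 hT.hasSum
    convert h using 1
    funext q
    rw [ContinuousLinearMap.star_eq_adjoint, InnerProductSpace.adjoint_rankOne]
    refine ContinuousLinearMap.ext fun z => ?_
    simp only [x, y, Function.comp_apply, Equiv.prodComm_apply, Prod.fst_swap, Prod.snd_swap,
      InnerProductSpace.rankOne_apply, inner_smul_left, Complex.conj_ofReal, smul_smul,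
      h_symm q.1 q.2, mul_comm]
  · have h := (hT.hasSum.mapL (ContinuousLinearMap.apply ℂ EllTwo z)).mapL
      (innerSL ℂ (lp.single 2 i (1 : ℂ) : EllTwo))
    have hval (q : ℕ × ℕ) : innerSL ℂ (lp.single 2 i (1 : ℂ) : EllTwo)
        (ContinuousLinearMap.apply ℂ EllTwo z (InnerProductSpace.rankOne ℂ (x q) (y q))) =
        if q.1 = i then (a q.1 q.2 : ℂ) * z q.2 else 0 := by
      rw [ContinuousLinearMap.apply_apply, InnerProductSpace.rankOne_apply, innerSL_apply_apply,
        inner_smul_right, EllTwo.inner_single_one, EllTwo.inner_single_one, lp.coeFn_smul,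
        Pi.smul_apply, lp.single_apply, Pi.single_apply]
      by_cases hq : q.1 = i
      · simp [hq, mul_comm]
      · simp [hq, Ne.symm hq]
    simp only [hval] at h
    rw [innerSL_apply_apply, EllTwo.inner_single_one, ContinuousLinearMap.apply_apply] at h
    -- Pairing with the `i`-th basis vector kills every term outside row `i`.
    have hinj : Function.Injective fun j : ℕ => (i, j) := Prod.mk_right_injective i
    have h' := (hinj.hasSum_iff fun q hq => ?_).2 h
    · simpa [Function.comp_def] using h'
    · rw [if_neg]
      rintro rfl
      exact hq ⟨q.2, rfl⟩

theorem InducesOperator.coe_apply_ofReal {η : ℕ} {a : ℕ → ℕ → ℝ} {T : EllTwo →L[ℂ] EllTwo}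
    (hT : InducesOperator a T) (ha : IsBanded η a) {z : EllTwo} {x : ℕ → ℝ}
    (hz : ∀ i, z i = x i) (i : ℕ) : T z i = (bandedMulVec η a x i : ℂ) := by
  refine (hT z i).unique ?_
  simpa [hz] using (hasSum_bandedMulVec ha x i).mapL Complex.ofRealCLM

theorem InducesOperator.re_apply {η : ℕ} {a : ℕ → ℕ → ℝ} {T : EllTwo →L[ℂ] EllTwo}
    (hT : InducesOperator a T) (ha : IsBanded η a) (z : EllTwo) (i : ℕ) :
    (T z i).re = bandedMulVec η a (fun j => (z j).re) i := by
  refine HasSum.unique ?_ (hasSum_bandedMulVec ha _ i)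
  simpa using (hT z i).mapL Complex.reCLM

theorem exists_ellTwo_of_summable {x : ℕ → ℝ} (hx : Summable fun i => x i ^ 2) :
    ∃ z : EllTwo, ∀ i, z i = x i :=
  ⟨⟨fun i => (x i : ℂ), memℓp_gen (by simpa using hx)⟩, fun _ => rfl⟩

theorem EllTwo.summable_re_sq (z : EllTwo) : Summable fun i => (z i).re ^ 2 := by
  have h := (memℓp_gen_iff (by simp)).1 (lp.memℓp z)
  refine Summable.of_nonneg_of_le (fun i => sq_nonneg _) (fun i => ?_) h
  rw [← sq_abs]
  simpa using pow_le_pow_left₀ (abs_nonneg _) (Complex.abs_re_le_norm (z i)) 2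

/-- If `I + T` is invertible on `ℓ²`, then the matrix of `I + T` acts bijectively on the weighted
`ℓ²` spaces which the matrix of `T` maps into `ℓ²`. -/
theorem InducesOperator.bijOn {η : ℕ} {a : ℕ → ℕ → ℝ} {T : EllTwo →L[ℂ] EllTwo}
    (hT : InducesOperator a T) (ha : IsBanded η a) (hu : IsUnit (1 + T)) {D : Set (ℕ → ℝ)}
    (hD : ∀ x ∈ D, ∀ y : ℕ → ℝ, (Summable fun i => y i ^ 2) → x + y ∈ D)
    (haD : ∀ x ∈ D, ∀ y ∈ D, Summable fun i => bandedMulVec η a (x - y) i ^ 2) (h0 : 0 ∈ D) :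
    Set.BijOn (fun x i => x i + bandedMulVec η a x i) D D := by
  have hsub (x y : ℕ → ℝ) (i : ℕ) :
      bandedMulVec η a (x - y) i = bandedMulVec η a x i - bandedMulVec η a y i := by
    simp [bandedMulVec, mul_sub]
  have haD' (x) (hx : x ∈ D) : Summable fun i => bandedMulVec η a x i ^ 2 := by
    simpa using haD x hx 0 h0
  refine ⟨fun x hx => hD x hx _ (haD' x hx), fun x hx y hy hxy => ?_, fun y hy => ?_⟩
  -- Injectivity: equal images force `x - y = -a(x - y)`, which lies in `ℓ²` and hence in the kernel
  -- of `1 + T`.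
  · have hdiff (i : ℕ) : (x - y) i = -bandedMulVec η a (x - y) i := by
      have := congrFun hxy i
      simp only [hsub, Pi.sub_apply] at this ⊢
      linarith
    obtain ⟨z, hz⟩ := exists_ellTwo_of_summable (x := x - y)
      ((haD x hx y hy).congr fun i => by rw [hdiff i, neg_sq])
    have hTz : (1 + T) z = (1 + T) 0 := by
      rw [map_zero]
      ext i
      have := hT.coe_apply_ofReal ha hz i
      simp only [add_apply, one_apply_eq_self, lp.coeFn_add,
        Pi.add_apply, this, hz i, lp.coeFn_zero, Pi.zero_apply]
      rw [hdiff i]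
      simp
    have hz0 : z = 0 := by
      obtain ⟨u, hu⟩ := hu
      have h1 : (u⁻¹.1 * u.1) z = (u⁻¹.1 * u.1) 0 := by
        rw [mul_apply_eq_comp, mul_apply_eq_comp, hu, hTz]
      simpa using h1
    funext i
    have hi := hz i
    rw [hz0, lp.coeFn_zero, Pi.zero_apply] at hi
    have : (x - y) i = 0 := Complex.ofReal_eq_zero.1 hi.symm
    simpa [sub_eq_zero] using this
  -- Surjectivity: with `(1 + T) z = -a y` in `ℓ²`, the preimage of `y` is `y + Re z`; real parts
  -- are harmless since `a` is real.
  · obtain ⟨g, hg⟩ := exists_ellTwo_of_summable (haD' y hy)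
    obtain ⟨z, hz⟩ : ∃ z, (1 + T) z = -g := by
      obtain ⟨u, hu⟩ := hu
      refine ⟨u⁻¹.1 (-g), ?_⟩
      rw [← hu, ← mul_apply_eq_comp, Units.mul_inv, one_apply_eq_self]
    refine ⟨y + fun i => (z i).re, hD y hy _ z.summable_re_sq, ?_⟩
    funext i
    have hi : (z i).re + bandedMulVec η a (fun j => (z j).re) i = -bandedMulVec η a y i := by
      have h1 := congrArg (fun f : EllTwo => (f i).re) hz
      simpa [hg i, hT.re_apply ha z i] using h1
    have hadd : bandedMulVec η a (y + fun i => (z i).re) i =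
        bandedMulVec η a y i + bandedMulVec η a (fun j => (z j).re) i := by
      simp [bandedMulVec, mul_add, Finset.sum_add_distrib]
    simp only [hadd, Pi.add_apply]
    linarith

end MatrixOperator

/-! ### Assembly of the four assertions -/

theorem mainTheorem4 (p α : ℕ → ℝ) (hp : ∀ j, 0 < p j) (hα : ∀ j, 0 < α j)
    (hp_sum : Summable p) (hα_sum : Summable α)
    (hp_ratio : ∃ m M : ℝ, 0 < m ∧ m < M ∧ ∀ j, p (j + 1) / p j ∈ Set.Ioo m M)
    (hαp : BddAbove (Set.range fun j => α j / p j))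
    (η : ℕ) (bhat : ℕ → ℕ → ℝ) (h_band : IsBanded η bhat)
    (h_bound : ∀ i j, |bhat i j| ≤ α i) (h_symm : ∀ i j, bhat i j = bhat j i) :
    ∃ (Bhat : EllTwo →L[ℂ] EllTwo) (B : (ℕ → ℝ) → (ℕ → ℝ)),
      InducesOperator bhat Bhat ∧ InducesTransformation (onePlus bhat) B ∧
      -- (1)
      IsTraceClass Bhat ∧
      -- (2)
      FredholmDetWellDefined Bhat ∧
      (fredholmDet Bhat ≠ 0 ↔ IsUnit (1 + Bhat)) ∧
      -- (3)
      (∃ C : ℝ, 0 < C ∧ ∀ x : ℕ → ℝ, Summable (fun j => x j ^ 2 * p j) →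
        Summable (fun j => x j ^ 2 - B x j ^ 2) ∧
        |∑' j, (x j ^ 2 - B x j ^ 2)| ≤ C * ∑' j, x j ^ 2 * p j) ∧
      -- (4)
      (fredholmDet Bhat ≠ 0 → InvertibleModNull gaussianInf B) := by
  have habs : Summable fun q : ℕ × ℕ => |bhat q.1 q.2| := by
    simpa using (summable_abs_mul_fst h_band h_bound (f := fun _ => 1) (fun _ => zero_le_one)
      (by simpa using hα_sum)).1
  obtain ⟨T, u, v, hT, huv, hs, hind⟩ := exists_hasSum_rankOne_of_summable habs h_symm
  obtain ⟨hwd, hdet⟩ := fredholmDet_of_hasSum_rankOne hT huv hs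
  obtain ⟨K, hK⟩ := hαp
  have hKp (i : ℕ) : α i ≤ K * p i := (div_le_iff₀ (hp i)).1 (hK ⟨i, rfl⟩)
  have hK0 : 0 < K := (div_pos (hα 0) (hp 0)).trans_le (hK ⟨0, rfl⟩)
  have hα0 (i : ℕ) : 0 ≤ α i := (hα i).le
  have hS : 0 ≤ ∑' i, α i := tsum_nonneg hα0
  refine ⟨T, fun x i => x i + bandedMulVec η bhat x i, hind,
    fun x i => (hasSum_onePlus_mul h_band x i).tendsto_sum_nat,
    isTraceClass_of_hasSum_rankOne hT huv hs, hwd, hdet, ?_, fun hne => ?_⟩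
  · refine ⟨(2 + (2 * η + 1) * ∑' i, α i) * ((2 * η + 1) * K), by positivity, fun x hx => ?_⟩
    obtain ⟨h1, h2⟩ := summable_mul_sq_of_le hα0 hKp hx
    obtain ⟨h3, h4⟩ := summable_sq_sub_sq h_band h_bound h_symm hα_sum h1
    refine ⟨h3, h4.trans ?_⟩
    rw [mul_assoc, mul_assoc]
    gcongr
  · have hp0 (i : ℕ) : 0 ≤ p i := (hp i).le
    have hadd (x y : ℕ → ℝ) (hx : Summable fun j => x j ^ 2 * p j)
        (hy : Summable fun j => y j ^ 2 * p j) : Summable fun j => (x + y) j ^ 2 * p j := by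
      refine ((hx.add hy).mul_left 2).of_nonneg_of_le
        (fun j => mul_nonneg (sq_nonneg _) (hp0 j)) fun j => ?_
      rw [Pi.add_apply, ← add_mul, ← mul_assoc]
      exact mul_le_mul_of_nonneg_right (add_sq_le) (hp0 j)
    have h0 : (0 : ℕ → ℝ) ∈ {x : ℕ → ℝ | Summable fun j => x j ^ 2 * p j} := by
      simp [summable_zero]
    refine invertibleModNull_of_bijOn ?_ (measurableSet_summable_sq_mul hp0)
      (gaussianInf_compl_summable_sq_mul hp0 hp_sum) ⟨0, h0⟩
      (hind.bijOn h_band (hdet.1 hne) (fun x hx y hy => ?_) (fun x hx y hy => ?_) h0)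
    · exact measurable_id.add (measurable_bandedMulVec η bhat)
    -- `ℓ²` lies in the weighted space because `p j ≤ ∑ p`.
    · refine hadd x y hx ((hy.mul_right (∑' j, p j)).of_nonneg_of_le
        (fun j => mul_nonneg (sq_nonneg _) (hp0 j)) fun j => ?_)
      exact mul_le_mul_of_nonneg_left (hp_sum.le_tsum j fun i _ => hp0 i) (sq_nonneg _)
    · refine summable_sq_bandedMulVec h_band h_bound h_symm hα_sum
        (summable_mul_sq_of_le hα0 hKp ?_).1
      rw [sub_eq_add_neg]
      exact hadd x (-y) hx (by simpa using hy)
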